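/- Let $(W,S)$ be a Coxeter system with $S$ finite and length function $\ell$, and let $\theta$ be an involutive automorphism of $(W,S)$, i.e. a group automorphism of $W$ with $\theta^2=\mathrm{id}$ and $\theta(S)=S$. Let $\iota(\theta)=\{\theta(w^{-1})w : w\in W\}$ be the set of twisted identities, and let $\mathrm{Br}(\iota(\theta))$ be $\iota(\theta)$ with the order induced by the Bruhat order on $W$ (where $u\le v$ if and only if every reduced expression for $v$ has a subword representing $u$). For $w\in W$ and $s\in S$ put $w\underline{s}=ws$ if $\theta(s)ws=w$, and $w\underline{s}=\theta(s)ws$ otherwise; let $D_R(w)=\{s\in S : \ell(ws)<\ell(w)\}$. Let $u\le v$ in $\mathrm{Br}(\iota(\theta))$. If $u\underline{s}=us$ for some $s\in D_R(v)$, then the order complex of the open interval $(u,v)=\{x\in\iota(\theta) : u<x<v\}$, i.e. the simplicial complex of its finite chains, is collapsible: it can be reduced to a single vertex by a finite sequence of elementary collapses, each of which removes a nonempty face $\sigma$ that is properly contained in exactly one face $\tau$, together with $\tau$. -/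

import Mathlib

namespace PreAbstractSimplicialComplex

/-- The order complex of a set `P` of elements ordered by `r`: its faces are the nonempty finite
subsets of `P` that are chains for `r`. -/
def orderComplex {α : Type*} (r : α → α → Prop) (P : Set α) :
    PreAbstractSimplicialComplex α where
  faces := {c | c.Nonempty ∧ (c : Set α) ⊆ P ∧ IsChain r (c : Set α)}
  isRelLowerSet_faces := by
    rintro c ⟨hne, hP, hc⟩
    refine ⟨hne, fun d hd hdne => ⟨hdne, ?_, ?_⟩⟩
    · exact (Finset.coe_subset.mpr hd).trans hP
    · exact hc.mono (Finset.coe_subset.mpr hd)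

/-- `L` is obtained from `K` by an elementary collapse: there is a face `σ` of `K` that is properly
contained in exactly one face `τ` of `K`, and `L` is `K` with `σ` and `τ` removed. -/
def ElementaryCollapse {α : Type*} (K L : PreAbstractSimplicialComplex α) : Prop :=
  ∃ σ ∈ K.faces, ∃ τ ∈ K.faces, σ ⊂ τ ∧ (∀ ρ ∈ K.faces, σ ⊂ ρ → ρ = τ) ∧
    L.faces = K.faces \ {σ, τ}

/-- A complex is collapsible if a finite sequence of elementary collapses reduces it to a single
vertex. -/
def IsCollapsible {α : Type*} (K : PreAbstractSimplicialComplex α) : Prop :=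
  ∃ (L : PreAbstractSimplicialComplex α) (x : α),
    Relation.ReflTransGen ElementaryCollapse K L ∧ L.faces = {{x}}

end PreAbstractSimplicialComplex

namespace CoxeterSystem

/-- The Bruhat order: `u ≤ v` if every reduced word for `v` has a subword representing `u`. -/
def BruhatLE {B W : Type*} [Group W] {M : CoxeterMatrix B} (cs : CoxeterSystem M W)
    (u v : W) : Prop :=
  ∀ ω : List B, cs.IsReduced ω → cs.wordProd ω = v →
    ∃ ω' : List B, ω'.Sublist ω ∧ cs.wordProd ω' = u

/-- `θ` is an involutive automorphism of the Coxeter system: a group automorphism of `W` with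
`θ ∘ θ = id` that maps the set of simple reflections onto itself. -/
structure IsInvolutiveAut {B W : Type*} [Group W] {M : CoxeterMatrix B}
    (cs : CoxeterSystem M W) (θ : W ≃* W) : Prop where
  involutive : Function.Involutive θ
  image_simple : θ '' Set.range cs.simple = Set.range cs.simple

/-- The set `ι(θ)` of twisted identities `θ(w⁻¹) w`. -/
def twistedIdentities {W : Type*} [Group W] (θ : W ≃* W) : Set W :=
  {x | ∃ w : W, x = θ w⁻¹ * w}

open Classical in
/-- The twisted action of the simple reflection `s = cs.simple i` on `w`, which gives
`w s` if `θ(s) w s = w`, and `θ(s) w s` otherwise. -/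
noncomputable def twistedAct {B W : Type*} [Group W] {M : CoxeterMatrix B}
    (cs : CoxeterSystem M W) (θ : W ≃* W) (w : W) (i : B) : W :=
  if θ (cs.simple i) * w * cs.simple i = w then w * cs.simple i
  else θ (cs.simple i) * w * cs.simple i

/-- The open interval `(u, v)` in the set of twisted identities with the induced Bruhat order. -/
def twistedIoo {B W : Type*} [Group W] {M : CoxeterMatrix B} (cs : CoxeterSystem M W)
    (θ : W ≃* W) (u v : W) : Set W :=
  {x | x ∈ twistedIdentities θ ∧ (cs.BruhatLE u x ∧ x ≠ u) ∧ (cs.BruhatLE x v ∧ x ≠ v)}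

end CoxeterSystem

/-! Write s for the given simple reflection and let D = `lowerConj` send a twisted identity w to
θ(s)ws if s is a right descent of w, and to w otherwise. D is decreasing and idempotent, and the
two-sided lifting property makes it monotone for the Bruhat order (`lowerConj_mono`). The hypothesis
on u says θ(s)us = u. This rules out s as a descent of u, so D fixes u, and cancellation shows that
nothing else is sent to u. As s is a descent of v, D v < v. Hence D maps (u, v) to itself, with D v
as the greatest element of its image, and `isCollapsible_orderComplex_of_kernelOperator` applies.
The crux is `not_isRightDescent_of_conj_eq`: on twisted identities a descent never acts trivially.
It rests on the parity of inversion counts, a θ-invariant cocycle that detects descents. -/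

namespace PreAbstractSimplicialComplex

/-! ### Collapses of finite complexes and order complexes -/

variable {α : Type*}

open Classical in
/-- If every face containing `x` can be enlarged by a vertex `y ≠ x`, then a finite complex collapses
onto its subcomplex of faces avoiding `x`. -/
theorem collapse_deletion_of_dominated {K L : PreAbstractSimplicialComplex α}
    (hfin : K.faces.Finite) {x y : α} (hxy : x ≠ y)
    (hdom : ∀ σ ∈ K.faces, x ∈ σ → insert y σ ∈ K.faces)
    (hL : L.faces = {σ ∈ K.faces | x ∉ σ}) :
    Relation.ReflTransGen ElementaryCollapse K L := by
  induction hn : {σ ∈ K.faces | x ∈ σ}.ncard using Nat.strong_induction_on generalizing K with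
  | _ n ih =>
  by_cases hex : ∃ σ ∈ K.faces, x ∈ σ
  · obtain ⟨σ₀, hσ₀, hxσ₀⟩ := hex
    have hfin' : {σ ∈ K.faces | x ∈ σ ∧ y ∉ σ}.Finite := hfin.subset fun σ h => h.1
    have hne : {σ ∈ K.faces | x ∈ σ ∧ y ∉ σ}.Nonempty := by
      refine ⟨σ₀.erase y, ?_, by simp [hxy, hxσ₀], by simp⟩
      exact (K.isRelLowerSet_faces hσ₀).2 (Finset.erase_subset y σ₀)
        ⟨x, Finset.mem_erase.2 ⟨hxy, hxσ₀⟩⟩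
    -- By maximality among faces with x and without y, the only face properly containing σ is
    -- `insert y σ`, so this pair can be collapsed.
    obtain ⟨σ, ⟨hσ, hxσ, hyσ⟩, hmax⟩ := Set.exists_max_image _ Finset.card hfin' hne
    have hτ := hdom σ hσ hxσ
    have huniq : ∀ ρ ∈ K.faces, σ ⊂ ρ → ρ = insert y σ := by
      intro ρ hρ hσρ
      have hxρ := hσρ.1 hxσ
      have hyρ : y ∈ ρ := by
        by_contra hyρ
        exact absurd (Finset.card_lt_card hσρ) (not_lt.2 (hmax ρ ⟨hρ, hxρ, hyρ⟩))
      have hsub : σ ⊆ ρ.erase y := fun z hz =>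
        Finset.mem_erase.2 ⟨fun h => hyσ (h ▸ hz), hσρ.1 hz⟩
      have hface : ρ.erase y ∈ K.faces :=
        (K.isRelLowerSet_faces hρ).2 (Finset.erase_subset y ρ) ⟨x, hsub hxσ⟩
      rw [Finset.eq_of_subset_of_card_le hsub
        (hmax _ ⟨hface, hsub hxσ, Finset.notMem_erase y ρ⟩), Finset.insert_erase hyρ]
    have hστ : σ ⊂ insert y σ := Finset.ssubset_insert hyσ
    let K' : PreAbstractSimplicialComplex α :=
      { faces := K.faces \ {σ, insert y σ}
        isRelLowerSet_faces := by
          rintro ρ ⟨hρ, hρ'⟩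
          refine ⟨(K.isRelLowerSet_faces hρ).1, fun ρ' hle hne => ?_⟩
          refine ⟨(K.isRelLowerSet_faces hρ).2 hle hne, ?_⟩
          have key : ¬ σ ⊆ ρ := fun h => by
            rcases h.eq_or_ssubset with h | h
            · exact hρ' (Or.inl h.symm)
            · exact hρ' (Or.inr (huniq ρ hρ h))
          rintro (rfl | rfl)
          · exact key hle
          · exact key (hστ.1.trans hle) }
    have hstep : ElementaryCollapse K K' := ⟨σ, hσ, insert y σ, hτ, hστ, huniq, rfl⟩
    refine Relation.ReflTransGen.head hstep
      (ih _ ?_ (hfin.subset Set.sdiff_subset) ?_ ?_ rfl)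
    · rw [← hn]
      refine Set.ncard_lt_ncard ⟨fun ρ h => ⟨h.1.1, h.2⟩, fun h => ?_⟩
        (hfin.subset fun ρ h => h.1)
      exact (h ⟨hσ, hxσ⟩).1.2 (Or.inl rfl)
    · rintro ρ ⟨hρ, hρ'⟩ hxρ
      refine ⟨hdom ρ hρ hxρ, ?_⟩
      rintro (h | h)
      · exact hyσ (h ▸ Finset.mem_insert_self y ρ)
      · refine hρ' ?_
        by_cases hyρ : y ∈ ρ
        · rw [Finset.insert_eq_of_mem hyρ] at h
          exact Or.inr h
        · left
          rw [← Finset.erase_insert hyρ, h, Finset.erase_insert hyσ]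
    · rw [hL]
      ext ρ
      constructor
      · rintro ⟨hρ, hxρ⟩
        refine ⟨⟨hρ, ?_⟩, hxρ⟩
        rintro (rfl | rfl)
        · exact hxρ hxσ
        · exact hxρ (Finset.mem_insert_of_mem hxσ)
      · rintro ⟨hρ, hxρ⟩
        exact ⟨hρ.1, hxρ⟩
  · have : K = L := by
      ext ρ
      rw [hL]
      exact ⟨fun h => ⟨h, fun hx => hex ⟨ρ, h, hx⟩⟩, fun h => h.1⟩
    rw [this]

theorem finite_faces_orderComplex {r : α → α → Prop} {P : Set α} (hP : P.Finite) :
    (orderComplex r P).faces.Finite := by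
  refine (hP.toFinset.powerset.finite_toSet).subset fun σ hσ => ?_
  simpa using hσ.2.1

theorem IsCollapsible.of_collapse {K L : PreAbstractSimplicialComplex α}
    (h : Relation.ReflTransGen ElementaryCollapse K L) (hL : L.IsCollapsible) :
    K.IsCollapsible := by
  obtain ⟨L', x, hL', hx⟩ := hL
  exact ⟨L', x, h.trans hL', hx⟩

variable [PartialOrder α]

/-- Removing a point whose comparable points are all comparable with another fixed point `y` is a
collapse of the order complex. -/
theorem collapse_orderComplex_diff_singleton {P : Set α} (hP : P.Finite) {x y : α} (hy : y ∈ P)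
    (hxy : x ≠ y) (hdom : ∀ z ∈ P, z ≤ x ∨ x ≤ z → z ≤ y ∨ y ≤ z) :
    Relation.ReflTransGen ElementaryCollapse (orderComplex (· ≤ ·) P)
      (orderComplex (· ≤ ·) (P \ {x})) := by
  classical
  refine collapse_deletion_of_dominated (finite_faces_orderComplex hP) hxy ?_ ?_
  · rintro σ ⟨-, hσP, hσ⟩ hx
    refine ⟨Finset.insert_nonempty y σ, ?_, ?_⟩
    · rw [Finset.coe_insert]
      exact Set.insert_subset hy hσP
    · rw [Finset.coe_insert]
      refine hσ.insert fun z hz _ => ?_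
      refine (hdom z (hσP hz) ?_).symm
      by_cases hzx : z = x
      · exact Or.inl hzx.le
      · exact hσ hz hx hzx
  · ext σ
    constructor
    · rintro ⟨hne, hσP, hσ⟩
      exact ⟨⟨hne, fun z hz => (hσP hz).1, hσ⟩, fun hx => (hσP hx).2 rfl⟩
    · rintro ⟨⟨hne, hσP, hσ⟩, hx⟩
      exact ⟨hne, fun z hz => ⟨hσP hz, fun h => hx (h ▸ hz)⟩, hσ⟩

/-- The complex is a cone with apex m, so every other point is dominated by m and can be removed. -/
theorem isCollapsible_orderComplex_of_isGreatest {P : Set α} (hP : P.Finite) {m : α}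
    (hm : IsGreatest P m) : (orderComplex (· ≤ ·) P).IsCollapsible := by
  induction hn : P.ncard using Nat.strong_induction_on generalizing P with
  | _ n ih =>
  by_cases hex : ∃ x ∈ P, x ≠ m
  · obtain ⟨x, hx, hxm⟩ := hex
    refine .of_collapse (collapse_orderComplex_diff_singleton hP hm.1 hxm
      fun z hz _ => Or.inl (hm.2 hz)) (ih _ ?_ hP.sdiff ?_ rfl)
    · exact hn ▸ Set.ncard_sdiff_singleton_lt_of_mem hx hP
    · exact ⟨⟨hm.1, hxm.symm⟩, fun z hz => hm.2 hz.1⟩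
  · push Not at hex
    refine ⟨_, m, Relation.ReflTransGen.refl, ?_⟩
    ext σ
    rw [Set.mem_singleton_iff]
    constructor
    · rintro ⟨hne, hσP, -⟩
      exact Finset.eq_singleton_iff_nonempty_unique_mem.2 ⟨hne, fun z hz => hex z (hσP hz)⟩
    · rintro rfl
      exact ⟨Finset.singleton_nonempty m, by simpa using hm.1, by simp⟩

/-- A finite poset with a monotone, idempotent, decreasing self-map whose image has a greatest
element has a collapsible order complex. -/
theorem isCollapsible_orderComplex_of_kernelOperator {P : Set α} (hP : P.Finite) {D : α → α} {m : α}
    (hm : m ∈ P) (hmaps : Set.MapsTo D P P) (hmono : MonotoneOn D P) (hle : ∀ x ∈ P, D x ≤ x)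
    (hidem : ∀ x ∈ P, D (D x) = D x) (hDm : D m = m) (hDle : ∀ x ∈ P, D x ≤ m) :
    (orderComplex (· ≤ ·) P).IsCollapsible := by
  induction hn : P.ncard using Nat.strong_induction_on generalizing P with
  | _ n ih =>
  by_cases hex : ∃ x ∈ P, D x ≠ x
  · obtain ⟨x, ⟨hx, hDx⟩, hmin⟩ :=
      (hP.subset (fun x h => h.1 : {x ∈ P | D x ≠ x} ⊆ P)).exists_minimal hex
    refine .of_collapse (collapse_orderComplex_diff_singleton hP (hmaps hx) hDx.symm ?_)
      (ih _ ?_ hP.sdiff ?_ ?_ ?_ ?_ ?_ ?_ rfl)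
    · rintro z hz (hzx | hxz)
      · by_cases hDz : D z = z
        · exact Or.inl (hDz ▸ hmono hz hx hzx)
        · exact Or.inr ((hle x hx).trans (hmin ⟨hz, hDz⟩ hzx))
      · exact Or.inr ((hle x hx).trans hxz)
    · exact hn ▸ Set.ncard_sdiff_singleton_lt_of_mem hx hP
    · exact ⟨hm, fun h => hDx (by rw [← Set.mem_singleton_iff.1 h, hDm])⟩
    · intro z hz
      refine ⟨hmaps hz.1, fun h => hDx ?_⟩
      rw [← Set.mem_singleton_iff.1 h, hidem z hz.1]
    · exact hmono.mono Set.sdiff_subset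
    · exact fun z hz => hle z hz.1
    · exact fun z hz => hidem z hz.1
    · exact fun z hz => hDle z hz.1
  · push Not at hex
    exact isCollapsible_orderComplex_of_isGreatest hP
      ⟨hm, fun x hx => hex x hx ▸ hDle x hx⟩

end PreAbstractSimplicialComplex

/-! ### Inversion parity, exchange and deletion -/

namespace CoxeterSystem

variable {B W : Type*} [Group W] {M : CoxeterMatrix B} (cs : CoxeterSystem M W)

open Classical in
/-- The action of the `i`th generator on `W × ZMod 2`: conjugation on the first component, with the
second component flipped at the simple reflection itself. -/
noncomputable def signedConj (i : B) : Function.End (W × ZMod 2) :=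
  fun p => (cs.simple i * p.1 * cs.simple i, p.2 + if p.1 = cs.simple i then 1 else 0)

-- With r = s_i s_j, the relation s_j r^n = r^(-n) s_j turns each flip condition on a conjugate into
-- a condition r^l t = s_j, where t is the first component. Each factor contributes two values of l.
open Classical in
theorem signedConj_mul_pow (i j : B) (n : ℕ) (p : W × ZMod 2) :
    ((cs.signedConj i * cs.signedConj j) ^ n) p =
      ((cs.simple i * cs.simple j) ^ n * p.1 * ((cs.simple i * cs.simple j) ^ n)⁻¹,
        p.2 + ∑ l ∈ Finset.range (2 * n),
          if (cs.simple i * cs.simple j) ^ l * p.1 = cs.simple j then 1 else 0) := by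
  have hinv : (cs.simple i * cs.simple j)⁻¹ = cs.simple j * cs.simple i := by simp
  have hconj : ∀ n : ℕ, cs.simple j * (cs.simple i * cs.simple j) ^ n =
      ((cs.simple i * cs.simple j) ^ n)⁻¹ * cs.simple j := by
    intro n
    induction n with
    | zero => simp
    | succ n ih =>
      rw [pow_succ, ← mul_assoc, ih, ← pow_succ, pow_succ', mul_inv_rev, hinv]
      simp [mul_assoc]
  induction n with
  | zero => simp [Function.End.one_def]
  | succ n ih =>
    rw [pow_succ']
    change cs.signedConj i (cs.signedConj j (((cs.signedConj i * cs.signedConj j) ^ n) p)) = _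
    rw [ih]
    set r := cs.simple i * cs.simple j with hr
    have h1 : r ^ n * p.1 * (r ^ n)⁻¹ = cs.simple j ↔ r ^ (2 * n) * p.1 = cs.simple j := by
      rw [mul_inv_eq_iff_eq_mul, hconj, eq_inv_mul_iff_mul_eq, ← mul_assoc, ← pow_add, two_mul]
    have h2 : cs.simple j * (r ^ n * p.1 * (r ^ n)⁻¹) * cs.simple j = cs.simple i ↔
        r ^ (2 * n + 1) * p.1 = cs.simple j := by
      have h3 : ∀ X : W, cs.simple j * X * cs.simple j = cs.simple i ↔ X = r⁻¹ * cs.simple j := by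
        intro X
        constructor
        · intro h
          rw [hinv, ← h]
          simp [mul_assoc]
        · intro h
          rw [h, hinv]
          simp [mul_assoc]
      rw [h3, mul_inv_eq_iff_eq_mul, mul_assoc, hconj, ← mul_assoc, ← mul_inv_rev, ← pow_succ,
        eq_inv_mul_iff_mul_eq, ← mul_assoc, ← pow_add, show n + 1 + n = 2 * n + 1 by ring]
    refine Prod.ext ?_ ?_
    · simp only [signedConj, pow_succ', mul_inv_rev, hinv]
      simp [hr, mul_assoc]
    · simp only [signedConj, h1, h2]
      rw [show 2 * (n + 1) = 2 * n + 1 + 1 by ring, Finset.sum_range_succ, Finset.sum_range_succ]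
      simp only [add_assoc]

theorem isLiftable_signedConj : M.IsLiftable cs.signedConj := by
  classical
  intro i j
  funext p
  -- Since r^m = 1 for m = M i j, the two halves of the sum agree and cancel modulo 2.
  rw [signedConj_mul_pow, cs.simple_mul_simple_pow, two_mul, Finset.sum_range_add]
  simp only [pow_add, cs.simple_mul_simple_pow, one_mul, ← two_mul]
  rw [show (2 : ZMod 2) = 0 from rfl]
  simp [Function.End.one_def]

/-- The action of `W` on `W × ZMod 2` extending `signedConj`. -/
noncomputable def signedConjHom : W →* Function.End (W × ZMod 2) :=
  cs.lift ⟨cs.signedConj, cs.isLiftable_signedConj⟩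

/-- The number modulo `2` of occurrences of `t` in the right inversion sequence of any word
representing `w`. -/
noncomputable def inversionParity (w t : W) : ZMod 2 :=
  (cs.signedConjHom w (t, 0)).2

open Classical in
theorem signedConjHom_wordProd (ω : List B) (p : W × ZMod 2) :
    cs.signedConjHom (cs.wordProd ω) p =
      (cs.wordProd ω * p.1 * (cs.wordProd ω)⁻¹, p.2 + (cs.rightInvSeq ω).count p.1) := by
  induction ω with
  | nil => simp [Function.End.one_def]
  | cons i ω ih =>
    rw [wordProd_cons, map_mul, signedConjHom, lift_apply_simple]
    change cs.signedConj i (cs.signedConjHom (cs.wordProd ω) p) = _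
    rw [ih, signedConj, rightInvSeq, List.count_cons]
    refine Prod.ext ?_ ?_
    · simp [mul_assoc]
    · have : cs.wordProd ω * p.1 * (cs.wordProd ω)⁻¹ = cs.simple i ↔
          (cs.wordProd ω)⁻¹ * cs.simple i * cs.wordProd ω = p.1 := by
        rw [mul_inv_eq_iff_eq_mul, mul_assoc, inv_mul_eq_iff_eq_mul, eq_comm]
      simp only [this, beq_iff_eq]
      push_cast
      rw [add_assoc]

open Classical in
theorem inversionParity_wordProd (ω : List B) (t : W) :
    cs.inversionParity (cs.wordProd ω) t = (cs.rightInvSeq ω).count t := by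
  simp [inversionParity, signedConjHom_wordProd]

/-- The cocycle rule expresses that `signedConjHom` is multiplicative. -/
theorem inversionParity_mul (w w' t : W) : cs.inversionParity (w * w') t =
    cs.inversionParity w' t + cs.inversionParity w (w' * t * w'⁻¹) := by
  obtain ⟨ω, rfl⟩ := cs.wordProd_surjective w
  obtain ⟨ω', rfl⟩ := cs.wordProd_surjective w'
  rw [inversionParity, map_mul]
  change (cs.signedConjHom _ (cs.signedConjHom _ _)).2 = _
  rw [inversionParity_wordProd, inversionParity_wordProd, signedConjHom_wordProd,
    signedConjHom_wordProd]
  simp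

theorem inversionParity_one (t : W) : cs.inversionParity 1 t = 0 := by
  simp [inversionParity, Function.End.one_def]

theorem mem_rightInvSeq_of_inversionParity_ne_zero {ω : List B} {t : W}
    (h : cs.inversionParity (cs.wordProd ω) t ≠ 0) : t ∈ cs.rightInvSeq ω := by
  classical
  by_contra ht
  exact h (by rw [inversionParity_wordProd, List.count_eq_zero_of_not_mem ht, Nat.cast_zero])

theorem length_mul_lt_of_inversionParity_ne_zero {w t : W} (h : cs.inversionParity w t ≠ 0) :
    cs.length (w * t) < cs.length w := by
  obtain ⟨ω, hω, rfl⟩ := cs.exists_isReduced w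
  exact (cs.isRightInversion_of_mem_rightInvSeq hω
    (cs.mem_rightInvSeq_of_inversionParity_ne_zero h)).2

/-- Passing from w to ws flips the parity at s, and odd parity forces the length to drop. A descent
of even parity would thus make s a descent of ws too. -/
theorem inversionParity_simple_ne_zero_iff {w : W} {i : B} :
    cs.inversionParity w (cs.simple i) ≠ 0 ↔ cs.IsRightDescent w i := by
  refine ⟨cs.length_mul_lt_of_inversionParity_ne_zero, fun h h0 => ?_⟩
  have h1 : cs.inversionParity (cs.simple i) (cs.simple i) = 1 := by
    have := cs.inversionParity_wordProd [i] (cs.simple i)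
    simpa using this
  have h2 : cs.inversionParity (w * cs.simple i) (cs.simple i) ≠ 0 := by
    rw [inversionParity_mul, h1]
    simp [h0]
  have h3 := cs.length_mul_lt_of_inversionParity_ne_zero h2
  rw [simple_mul_simple_cancel_right] at h3
  exact lt_asymm h h3

/-- The exchange property: right multiplication by a right descent deletes a letter. -/
theorem exists_eraseIdx_of_isRightDescent {ω : List B} {i : B}
    (h : cs.IsRightDescent (cs.wordProd ω) i) :
    ∃ k < ω.length, cs.wordProd ω * cs.simple i = cs.wordProd (ω.eraseIdx k) := by
  have hmem := cs.mem_rightInvSeq_of_inversionParity_ne_zero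
    (cs.inversionParity_simple_ne_zero_iff.2 h)
  obtain ⟨k, hk, hk'⟩ := List.mem_iff_getElem.1 hmem
  refine ⟨k, by simpa using hk, ?_⟩
  rw [← wordProd_mul_getD_rightInvSeq, List.getD_eq_getElem _ 1 hk, hk']

/-- The exchange property: left multiplication by a left descent deletes a letter. -/
theorem exists_eraseIdx_of_isLeftDescent {ω : List B} {i : B}
    (h : cs.IsLeftDescent (cs.wordProd ω) i) :
    ∃ k < ω.length, cs.simple i * cs.wordProd ω = cs.wordProd (ω.eraseIdx k) := by
  have h' : cs.IsRightDescent (cs.wordProd ω.reverse) i := by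
    rwa [wordProd_reverse, isRightDescent_inv_iff]
  have hmem := cs.mem_rightInvSeq_of_inversionParity_ne_zero
    (cs.inversionParity_simple_ne_zero_iff.2 h')
  rw [rightInvSeq_reverse, List.mem_reverse] at hmem
  obtain ⟨k, hk, hk'⟩ := List.mem_iff_getElem.1 hmem
  refine ⟨k, by simpa using hk, ?_⟩
  rw [← getD_leftInvSeq_mul_wordProd, List.getD_eq_getElem _ 1 hk, hk']

/-- The deletion property: every word has a reduced subword with the same product. -/
theorem exists_reduced_sublist (ω : List B) :
    ∃ ω' : List B, ω'.Sublist ω ∧ cs.IsReduced ω' ∧ cs.wordProd ω' = cs.wordProd ω := by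
  induction ω with
  | nil => exact ⟨[], List.Sublist.refl _, by simp [IsReduced], rfl⟩
  | cons i ω ih =>
    obtain ⟨ω', hsub, hred, hprod⟩ := ih
    by_cases h : cs.IsLeftDescent (cs.wordProd ω') i
    · obtain ⟨k, hk, hk'⟩ := cs.exists_eraseIdx_of_isLeftDescent h
      refine ⟨ω'.eraseIdx k, ((List.eraseIdx_sublist _ _).trans hsub).cons i, ?_, ?_⟩
      · rw [isLeftDescent_iff, hk', hred.eq] at h
        have := List.length_eraseIdx_add_one hk
        unfold IsReduced
        omega
      · rw [← hk', hprod, wordProd_cons]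
    · refine ⟨i :: ω', hsub.cons_cons i, ?_, ?_⟩
      · rw [not_isLeftDescent_iff, hred.eq] at h
        rw [IsReduced, wordProd_cons, h, List.length_cons]
      · rw [wordProd_cons, wordProd_cons, hprod]

/-! ### Bruhat order and lifting -/

variable {cs}

theorem BruhatLE.refl (u : W) : cs.BruhatLE u u :=
  fun ω _ hω => ⟨ω, List.Sublist.refl ω, hω⟩

theorem BruhatLE.exists_reduced {u v : W} (h : cs.BruhatLE u v) {ω : List B}
    (hω : cs.IsReduced ω) (hv : cs.wordProd ω = v) :
    ∃ ω' : List B, ω'.Sublist ω ∧ cs.IsReduced ω' ∧ cs.wordProd ω' = u := by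
  obtain ⟨ω', hsub, hu⟩ := h ω hω hv
  obtain ⟨ω'', hsub', hred, hprod⟩ := cs.exists_reduced_sublist ω'
  exact ⟨ω'', hsub'.trans hsub, hred, hprod.trans hu⟩

theorem BruhatLE.trans {u v w : W} (huv : cs.BruhatLE u v) (hvw : cs.BruhatLE v w) :
    cs.BruhatLE u w := by
  intro ω hω hw
  obtain ⟨ω', hsub, hred, hv⟩ := hvw.exists_reduced hω hw
  obtain ⟨ω'', hsub', hu⟩ := huv ω' hred hv
  exact ⟨ω'', hsub'.trans hsub, hu⟩

theorem BruhatLE.antisymm {u v : W} (huv : cs.BruhatLE u v) (hvu : cs.BruhatLE v u) : u = v := by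
  obtain ⟨ω, hω, rfl⟩ := cs.exists_isReduced v
  obtain ⟨ω', hsub, hred, rfl⟩ := huv.exists_reduced hω rfl
  obtain ⟨ω'', hsub', hred', hprod⟩ := hvu.exists_reduced hred rfl
  have h1 : ω''.length = ω.length := by rw [← hω.eq, ← hred'.eq, hprod]
  rw [hsub.eq_of_length_le (h1 ▸ hsub'.length_le)]

theorem finite_setOf_bruhatLE (v : W) : {u | cs.BruhatLE u v}.Finite := by
  obtain ⟨ω, hω, rfl⟩ := cs.exists_isReduced v
  refine ((List.finite_toSet ω.sublists).image cs.wordProd).subset ?_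
  intro u hu
  obtain ⟨ω', hsub, hprod⟩ := hu ω hω rfl
  exact ⟨ω', by simpa using hsub, hprod⟩

theorem IsRightDescent.bruhatLE {w : W} {i : B} (h : cs.IsRightDescent w i) :
    cs.BruhatLE (w * cs.simple i) w := by
  rintro ω - rfl
  obtain ⟨k, -, hk⟩ := cs.exists_eraseIdx_of_isRightDescent h
  exact ⟨ω.eraseIdx k, List.eraseIdx_sublist _ _, hk.symm⟩

theorem IsLeftDescent.bruhatLE {w : W} {i : B} (h : cs.IsLeftDescent w i) :
    cs.BruhatLE (cs.simple i * w) w := by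
  rintro ω - rfl
  obtain ⟨k, -, hk⟩ := cs.exists_eraseIdx_of_isLeftDescent h
  exact ⟨ω.eraseIdx k, List.eraseIdx_sublist _ _, hk.symm⟩

/-- The lifting property of the Bruhat order, on the left. -/
theorem BruhatLE.le_simple_mul {x y : W} {i : B} (hxy : cs.BruhatLE x y)
    (hx : ¬cs.IsLeftDescent x i) (hy : cs.IsLeftDescent y i) :
    cs.BruhatLE x (cs.simple i * y) := by
  intro ω hω hprod
  have hy' : cs.wordProd (i :: ω) = y := by
    rw [wordProd_cons, hprod, simple_mul_simple_cancel_left]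
  have hred : cs.IsReduced (i :: ω) := by
    rw [isLeftDescent_iff, ← hprod, hω.eq] at hy
    rw [IsReduced, hy', ← hy, List.length_cons]
  obtain ⟨ω', hsub, hred', rfl⟩ := hxy.exists_reduced hred hy'
  -- A reduced subword using the leading letter i would make i a left descent of x.
  rcases List.sublist_cons_iff.1 hsub with h | ⟨ω'', rfl, -⟩
  · exact ⟨ω', h, rfl⟩
  · refine absurd ?_ hx
    rw [IsLeftDescent, hred'.eq, wordProd_cons, simple_mul_simple_cancel_left, List.length_cons]
    exact Nat.lt_succ_of_le (cs.length_wordProd_le ω'')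

theorem BruhatLE.inv {u v : W} (h : cs.BruhatLE u v) : cs.BruhatLE u⁻¹ v⁻¹ := by
  intro ω hω hprod
  obtain ⟨ω', hsub, hu⟩ := h ω.reverse hω.reverse (by rw [wordProd_reverse, hprod, inv_inv])
  exact ⟨ω'.reverse, by simpa using hsub.reverse, by rw [wordProd_reverse, hu]⟩

/-- The lifting property of the Bruhat order, on the right. -/
theorem BruhatLE.le_mul_simple {x y : W} {i : B} (hxy : cs.BruhatLE x y)
    (hx : ¬cs.IsRightDescent x i) (hy : cs.IsRightDescent y i) :
    cs.BruhatLE x (y * cs.simple i) := by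
  have := (hxy.inv.le_simple_mul (i := i) (by rwa [isLeftDescent_inv_iff])
    (by rwa [isLeftDescent_inv_iff])).inv
  simpa using this

/-- If `i` is a left and `j` a right descent of `w`, then multiplying by both lowers the length
by two unless they act on `w` in the same way. -/
theorem length_simple_mul_mul_simple {w : W} {i j : B} (hi : cs.IsLeftDescent w i)
    (hj : cs.IsRightDescent w j) (hne : cs.simple i * w * cs.simple j ≠ w) :
    cs.length (cs.simple i * w * cs.simple j) + 2 = cs.length w := by
  obtain ⟨ω, hω, hprod⟩ := cs.exists_isReduced (w * cs.simple j)
  have hw : w = cs.wordProd (ω ++ [j]) := by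
    rw [wordProd_append, ← hprod, wordProd_singleton, simple_mul_simple_cancel_right]
  have hlen : cs.length w = ω.length + 1 := by
    rw [← cs.isRightDescent_iff.1 hj, hprod, hω.eq]
  obtain ⟨k, hk, hk'⟩ := cs.exists_eraseIdx_of_isLeftDescent (hw ▸ hi)
  rw [← hw] at hk'
  rw [List.length_append, List.length_singleton] at hk
  -- Deleting the final letter j would give s_i w = w s_j, which `hne` excludes.
  have hk2 : k < ω.length := by
    by_contra hlt
    have hkeq : k = ω.length := by omega
    subst hkeq
    rw [List.eraseIdx_append_of_length_le le_rfl] at hk'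
    simp only [tsub_self, List.eraseIdx_cons_zero, List.append_nil] at hk'
    exact hne (by rw [hk', ← hprod, simple_mul_simple_cancel_right])
  rw [List.eraseIdx_append_of_lt_length hk2, wordProd_append, wordProd_singleton] at hk'
  have h1 : cs.length (cs.simple i * w * cs.simple j) ≤ (ω.eraseIdx k).length := by
    rw [hk', simple_mul_simple_cancel_right]
    exact cs.length_wordProd_le _
  have h2 := List.length_eraseIdx_add_one hk2
  have h3 := cs.length_mul_simple (cs.simple i * w) j
  have h4 := cs.isLeftDescent_iff.1 hi
  omega

variable (cs) in
/-- The Bruhat order as a partial order. -/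
abbrev bruhatPartialOrder : PartialOrder W where
  le := cs.BruhatLE
  le_refl := BruhatLE.refl
  le_trans _ _ _ := BruhatLE.trans
  le_antisymm _ _ := BruhatLE.antisymm

end CoxeterSystem

/-! ### Twisted identities and their descents -/

namespace CoxeterSystem

variable {B W : Type*} [Group W] {M : CoxeterMatrix B} {cs : CoxeterSystem M W} {θ : W ≃* W}

namespace IsInvolutiveAut

variable (hθ : cs.IsInvolutiveAut θ)

include hθ

theorem exists_simple (i : B) : ∃ j, θ (cs.simple i) = cs.simple j := by
  have h : θ (cs.simple i) ∈ Set.range cs.simple :=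
    hθ.image_simple ▸ Set.mem_image_of_mem θ (Set.mem_range_self i)
  obtain ⟨j, hj⟩ := h
  exact ⟨j, hj.symm⟩

theorem exists_rightInvSeq_map (ω : List B) : ∃ ω' : List B, ω'.length = ω.length ∧
    cs.wordProd ω' = θ (cs.wordProd ω) ∧ cs.rightInvSeq ω' = (cs.rightInvSeq ω).map θ := by
  induction ω with
  | nil => exact ⟨[], by simp⟩
  | cons i ω ih =>
    obtain ⟨ω', hlen, hprod, hris⟩ := ih
    obtain ⟨j, hj⟩ := hθ.exists_simple i
    exact ⟨j :: ω', by simp [hlen], by simp [wordProd_cons, hprod, hj],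
      by simp [rightInvSeq, hprod, hris, hj]⟩

theorem length_map (w : W) : cs.length (θ w) = cs.length w := by
  have key : ∀ w, cs.length (θ w) ≤ cs.length w := by
    intro w
    obtain ⟨ω, hω, rfl⟩ := cs.exists_isReduced w
    obtain ⟨ω', hlen, hprod, -⟩ := hθ.exists_rightInvSeq_map ω
    rw [← hprod, hω.eq, ← hlen]
    exact cs.length_wordProd_le ω'
  refine (key w).antisymm ?_
  simpa only [hθ.involutive w] using key (θ w)

theorem inversionParity_map (w t : W) :
    cs.inversionParity (θ w) (θ t) = cs.inversionParity w t := by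
  classical
  obtain ⟨ω, rfl⟩ := cs.wordProd_surjective w
  obtain ⟨ω', -, hprod, hris⟩ := hθ.exists_rightInvSeq_map ω
  rw [← hprod, inversionParity_wordProd, inversionParity_wordProd, hris,
    List.count_map_of_injective _ _ θ.injective]

theorem map_eq_inv {w : W} (hw : w ∈ twistedIdentities θ) : θ w = w⁻¹ := by
  obtain ⟨a, rfl⟩ := hw
  simp [hθ.involutive a]

/-- Because θ(w) = w⁻¹, the elements s_j w and w s_i are exchanged by θ and inversion, which
preserve length. -/
theorem isLeftDescent_iff {w : W} (hw : w ∈ twistedIdentities θ) {i j : B}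
    (hj : θ (cs.simple i) = cs.simple j) : cs.IsLeftDescent w j ↔ cs.IsRightDescent w i := by
  have h : cs.simple j * w = (θ (w * cs.simple i))⁻¹ := by
    rw [map_mul, hθ.map_eq_inv hw, hj]
    simp
  rw [IsLeftDescent, IsRightDescent, h, length_inv, hθ.length_map]

/-- A simple reflection that fixes a twisted identity under the twisted conjugation action is not
one of its right descents. -/
theorem not_isRightDescent_of_conj_eq {w : W} (hw : w ∈ twistedIdentities θ) {i : B}
    (h : θ (cs.simple i) * w * cs.simple i = w) : ¬cs.IsRightDescent w i := by
  obtain ⟨a, rfl⟩ := hw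
  have hfix : θ (a * cs.simple i * a⁻¹) = a * cs.simple i * a⁻¹ := by
    calc θ (a * cs.simple i * a⁻¹)
        = θ a * (θ (cs.simple i) * (θ a⁻¹ * a) * cs.simple i) * (cs.simple i * a⁻¹) := by
          simp [mul_assoc]
      _ = a * cs.simple i * a⁻¹ := by rw [h]; simp [mul_assoc]
  -- As θ fixes t = a s a⁻¹, the parity of θ(a⁻¹) at t equals that of a⁻¹. The cocycle rule then
  -- gives w the same parity at s as a⁻¹a = 1.
  rw [← inversionParity_simple_ne_zero_iff, not_not, inversionParity_mul, ← hfix,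
    hθ.inversionParity_map, ← inversionParity_mul, inv_mul_cancel, inversionParity_one]

end IsInvolutiveAut

theorem conj_mem_twistedIdentities {w : W} (hw : w ∈ twistedIdentities θ) (i : B) :
    θ (cs.simple i) * w * cs.simple i ∈ twistedIdentities θ := by
  obtain ⟨a, rfl⟩ := hw
  exact ⟨a * cs.simple i, by simp [mul_assoc]⟩

/-! ### The lowering operator -/

variable (cs θ) in
open Classical in
/-- The twisted conjugate of `w` by a simple reflection if that is a right descent of `w`, and `w`
otherwise. -/
noncomputable def lowerConj (i : B) (w : W) : W :=
  if cs.IsRightDescent w i then θ (cs.simple i) * w * cs.simple i else w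

theorem lowerConj_of_isRightDescent {w : W} {i : B} (h : cs.IsRightDescent w i) :
    cs.lowerConj θ i w = θ (cs.simple i) * w * cs.simple i := if_pos h

theorem lowerConj_of_not_isRightDescent {w : W} {i : B} (h : ¬cs.IsRightDescent w i) :
    cs.lowerConj θ i w = w := if_neg h

theorem lowerConj_mem_twistedIdentities {w : W} (hw : w ∈ twistedIdentities θ) (i : B) :
    cs.lowerConj θ i w ∈ twistedIdentities θ := by
  rw [lowerConj]
  split_ifs
  · exact conj_mem_twistedIdentities hw i
  · exact hw

namespace IsInvolutiveAut

variable (hθ : cs.IsInvolutiveAut θ)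

include hθ

theorem length_lowerConj {w : W} (hw : w ∈ twistedIdentities θ) {i : B}
    (h : cs.IsRightDescent w i) : cs.length (cs.lowerConj θ i w) + 2 = cs.length w := by
  obtain ⟨j, hj⟩ := hθ.exists_simple i
  rw [lowerConj_of_isRightDescent h, hj]
  refine length_simple_mul_mul_simple ((hθ.isLeftDescent_iff hw hj).2 h) h fun heq => ?_
  exact hθ.not_isRightDescent_of_conj_eq hw (hj ▸ heq) h

theorem not_isRightDescent_lowerConj {w : W} (hw : w ∈ twistedIdentities θ) (i : B) :
    ¬cs.IsRightDescent (cs.lowerConj θ i w) i := by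
  by_cases h : cs.IsRightDescent w i
  · have h1 := hθ.length_lowerConj hw h
    have h2 := cs.isRightDescent_iff.1 h
    obtain ⟨j, hj⟩ := hθ.exists_simple i
    have h3 := cs.isLeftDescent_iff.1 ((hθ.isLeftDescent_iff hw hj).2 h)
    rw [IsRightDescent]
    have h4 : cs.lowerConj θ i w * cs.simple i = cs.simple j * w := by
      rw [lowerConj_of_isRightDescent h, hj, simple_mul_simple_cancel_right]
    rw [h4]
    omega
  · rwa [lowerConj_of_not_isRightDescent h]

theorem lowerConj_lowerConj {w : W} (hw : w ∈ twistedIdentities θ) (i : B) :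
    cs.lowerConj θ i (cs.lowerConj θ i w) = cs.lowerConj θ i w :=
  lowerConj_of_not_isRightDescent (hθ.not_isRightDescent_lowerConj hw i)

theorem isLeftDescent_mul_simple {w : W} (hw : w ∈ twistedIdentities θ) {i j : B}
    (h : cs.IsRightDescent w i) (hj : θ (cs.simple i) = cs.simple j) :
    cs.IsLeftDescent (w * cs.simple i) j := by
  have h1 := hθ.length_lowerConj hw h
  have h2 := cs.isRightDescent_iff.1 h
  rw [lowerConj_of_isRightDescent h, hj, mul_assoc] at h1
  rw [IsLeftDescent]
  omega

theorem lowerConj_le {w : W} (hw : w ∈ twistedIdentities θ) (i : B) :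
    cs.BruhatLE (cs.lowerConj θ i w) w := by
  by_cases h : cs.IsRightDescent w i
  · obtain ⟨j, hj⟩ := hθ.exists_simple i
    rw [lowerConj_of_isRightDescent h, hj, mul_assoc]
    exact (hθ.isLeftDescent_mul_simple hw h hj).bruhatLE.trans h.bruhatLE
  · rw [lowerConj_of_not_isRightDescent h]
    exact .refl w

/-- D x ≤ y, and D x has neither s as a right descent nor θ(s) as a left descent. If s is a descent
of y, lifting on the right and then on the left brings y down to D y while staying above D x. -/
theorem lowerConj_mono {x y : W} (hx : x ∈ twistedIdentities θ) (hy : y ∈ twistedIdentities θ)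
    (i : B) (hxy : cs.BruhatLE x y) :
    cs.BruhatLE (cs.lowerConj θ i x) (cs.lowerConj θ i y) := by
  have hle := (hθ.lowerConj_le hx i).trans hxy
  by_cases h : cs.IsRightDescent y i
  · obtain ⟨j, hj⟩ := hθ.exists_simple i
    have hnot := hθ.not_isRightDescent_lowerConj hx i
    rw [lowerConj_of_isRightDescent h, hj, mul_assoc]
    refine (hle.le_mul_simple hnot h).le_simple_mul ?_ (hθ.isLeftDescent_mul_simple hy h hj)
    rwa [hθ.isLeftDescent_iff (lowerConj_mem_twistedIdentities hx i) hj]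
  · rwa [lowerConj_of_not_isRightDescent h]

theorem conj_eq_of_twistedAct_eq {w : W} {i : B} (h : cs.twistedAct θ w i = w * cs.simple i) :
    θ (cs.simple i) * w * cs.simple i = w := by
  by_contra hne
  -- Otherwise θ(s)ws = ws, so θ(s) = 1, although θ(s) has length 1.
  rw [twistedAct, if_neg hne, mul_assoc, mul_eq_right] at h
  have := hθ.length_map (cs.simple i)
  simp [h] at this

end IsInvolutiveAut

end CoxeterSystem

open CoxeterSystem PreAbstractSimplicialComplex in
theorem mainTheorem3 {B W : Type*} [Finite B] [Group W] {M : CoxeterMatrix B}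
    (cs : CoxeterSystem M W) (θ : W ≃* W) (hθ : cs.IsInvolutiveAut θ)
    (u v : W) (hu : u ∈ CoxeterSystem.twistedIdentities θ)
    (hv : v ∈ CoxeterSystem.twistedIdentities θ) (huv : cs.BruhatLE u v)
    (i : B) (hi : cs.IsRightDescent v i)
    (hus : cs.twistedAct θ u i = u * cs.simple i) :
    (PreAbstractSimplicialComplex.orderComplex cs.BruhatLE
      (cs.twistedIoo θ u v)).IsCollapsible := by
  have hfix := hθ.conj_eq_of_twistedAct_eq hus
  have hnot := hθ.not_isRightDescent_of_conj_eq hu hfix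
  have hDu : cs.lowerConj θ i u = u := lowerConj_of_not_isRightDescent hnot
  -- If θ(s)xs = u = θ(s)us, cancellation gives x = u; this keeps D from leaving the open interval
  -- at the bottom.
  have hne : ∀ x, x ≠ u → cs.lowerConj θ i x ≠ u := by
    intro x hx hxu
    by_cases h : cs.IsRightDescent x i
    · rw [lowerConj_of_isRightDescent h, ← hfix] at hxu
      exact hx (mul_left_cancel (mul_right_cancel hxu))
    · exact hx (lowerConj_of_not_isRightDescent h ▸ hxu)
  have hle : ∀ x ∈ twistedIdentities θ, cs.BruhatLE u x →
      cs.BruhatLE u (cs.lowerConj θ i x) := fun x hx hux =>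
    hDu ▸ hθ.lowerConj_mono hu hx i hux
  have hvu : v ≠ u := fun h => hnot (h ▸ hi)
  let _ := cs.bruhatPartialOrder
  refine isCollapsible_orderComplex_of_kernelOperator (D := cs.lowerConj θ i)
    (m := cs.lowerConj θ i v) ((finite_setOf_bruhatLE v).subset fun x hx => hx.2.2.1)
    ?_ ?_ ?_ ?_ ?_ ?_ ?_
  · refine ⟨lowerConj_mem_twistedIdentities hv i, ⟨hle v hv huv, hne v hvu⟩,
      hθ.lowerConj_le hv i, fun h => ?_⟩
    have := hθ.length_lowerConj hv hi
    rw [h] at this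
    omega
  · rintro x ⟨hx, ⟨hux, hxu⟩, hxv, hxv'⟩
    refine ⟨lowerConj_mem_twistedIdentities hx i, ⟨hle x hx hux, hne x hxu⟩,
      (hθ.lowerConj_le hx i).trans hxv, fun h => hxv' (hxv.antisymm ?_)⟩
    exact h ▸ hθ.lowerConj_le hx i
  · exact fun x hx y hy hxy => hθ.lowerConj_mono hx.1 hy.1 i hxy
  · exact fun x hx => hθ.lowerConj_le hx.1 i
  · exact fun x hx => hθ.lowerConj_lowerConj hx.1 i
  · exact hθ.lowerConj_lowerConj hv i
  · exact fun x hx => hθ.lowerConj_mono hx.1 hv i hx.2.2.1
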